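/- Let $k,h\ge 0$ be integers. Let $F$ be a finite graph that is a forest of $h$ stars, i.e. $F$ has exactly $h$ connected components and each of them is a star (a vertex, called the root, adjacent to all other vertices of the component, with no further edges; a single vertex is allowed). Let $F$ be $k$-colored, i.e. its vertex set is partitioned into (possibly empty) classes $V_0,\dots,V_{k-1}$, and let $S$ be a finite set of points in the plane, partitioned into classes $S_0,\dots,S_{k-1}$, that is compatible with $F$: $|V_i|=|S_i|$ for every $i$. If $\min\{k,h\}\le 2$, that is, if there are at most two colors (and any number of stars) or at most two stars (and any number of colors), in particular if $\max\{k,h\}=2$, then $F$ has a $k$-colored point-set embedding on $S$ with curve complexity at most $2$. That is, there is a planar drawing of $F$ in which distinct vertices are represented by distinct points of $S$, every vertex of $V_i$ being represented by a point of $S_i$, every edge is drawn as a simple polyline joining the points of its end vertices, passing through no other vertex and meeting another edge only at the point of a common end vertex, and every edge has at most $2$ bends (points shared by two consecutive segments of its polyline). -/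

import Mathlib

/-- The Euclidean plane. -/
abbrev Plane : Type := EuclideanSpace ℝ (Fin 2)

/-! ### Forests of stars -/

/-- A star: a graph in which some vertex (the root) is adjacent to every other vertex, and there
are no other edges. A single vertex counts as a star. -/
def IsStar {V : Type*} (G : SimpleGraph V) : Prop :=
  ∃ r : V, G = SimpleGraph.starGraph r

/-- A forest of `h` stars: exactly `h` connected components, each of which is a star. -/
def IsForestOfStars {V : Type*} (G : SimpleGraph V) (h : ℕ) : Prop :=
  Nat.card G.ConnectedComponent = h ∧ ∀ C : G.ConnectedComponent, IsStar C.toSimpleGraph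

/-! ### Colored graphs and colored point sets

A `k`-coloring of a set `X`, that is, a partition of `X` into classes `X 0, …, X (k - 1)`, is given
by the function `X → Fin k` that maps each element to its color. -/

/-- The colored point set `(S, colS)` is compatible with the vertex coloring `colV`: every color
occurs on as many points as vertices. -/
def Compatible {V : Type*} {k : ℕ} (colV : V → Fin k) (S : Finset Plane) (colS : S → Fin k) :
    Prop :=
  ∀ i : Fin k, Nat.card {v : V // colV v = i} = Nat.card {p : S // colS p = i}

/-! ### Polylines -/

/-- The set of points covered by the polyline with the successive corner points `l`. -/
def polylineSet (l : List Plane) : Set Plane :=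
  {x | ∃ (i : ℕ) (hi : i + 1 < l.length), x ∈ segment ℝ l[i] l[i + 1]}

/-- The polyline with corner points `l` is a simple arc: it has at least one segment, its corner
points are distinct, consecutive segments share only their common corner point, and non-consecutive
segments are disjoint. -/
structure IsSimplePolyline (l : List Plane) : Prop where
  two_le : 2 ≤ l.length
  nodup : l.Nodup
  inter : ∀ (i j : ℕ) (hij : i < j) (hj : j + 1 < l.length) (x : Plane),
    x ∈ segment ℝ l[i] l[i + 1] → x ∈ segment ℝ l[j] l[j + 1] → j = i + 1 ∧ x = l[j]

/-! ### Planar polyline drawings -/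

/-- A planar drawing of `G` in which every edge is drawn as a polyline. -/
structure PolylineDrawing {V : Type*} (G : SimpleGraph V) where
  /-- the point that represents a vertex -/
  pos : V → Plane
  /-- distinct vertices are represented by distinct points -/
  pos_injective : Function.Injective pos
  /-- the corner points of the polyline that represents an edge, from one end to the other -/
  line : G.edgeSet → List Plane
  /-- every edge is drawn as a simple arc -/
  simple : ∀ e : G.edgeSet, IsSimplePolyline (line e)
  /-- the arc of an edge joins the points of its two end vertices -/
  ends : ∀ e : G.edgeSet, ∃ u v : V, (e : Sym2 V) = s(u, v) ∧
    (line e).head? = some (pos u) ∧ (line e).getLast? = some (pos v)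
  /-- an edge passes through no vertex except its end vertices -/
  avoid : ∀ (e : G.edgeSet) (w : V), pos w ∈ polylineSet (line e) → w ∈ (e : Sym2 V)
  /-- two edges meet only at common end vertices -/
  noncrossing : ∀ e f : G.edgeSet, e ≠ f → ∀ x ∈ polylineSet (line e) ∩ polylineSet (line f),
    ∃ w : V, w ∈ (e : Sym2 V) ∧ w ∈ (f : Sym2 V) ∧ x = pos w

namespace PolylineDrawing

variable {V : Type*} {G : SimpleGraph V}

/-- The number of bends of an edge: corner points shared by two consecutive segments, that is, all
corner points except the first and the last. -/
def bends (D : PolylineDrawing G) (e : G.edgeSet) : ℕ := (D.line e).length - 2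

/-- The curve complexity: the maximum number of bends along an edge (`0` if there is no edge). -/
noncomputable def curveComplexity (D : PolylineDrawing G) : ℕ∞ := ⨆ e : G.edgeSet, (D.bends e : ℕ∞)

/-- The drawing maps every vertex to a point of `S` of the same color. -/
def IsColoredEmbeddingOn {k : ℕ} (D : PolylineDrawing G) (colV : V → Fin k) (S : Finset Plane)
    (colS : S → Fin k) : Prop :=
  ∀ v : V, ∃ hv : D.pos v ∈ S, colS ⟨D.pos v, hv⟩ = colV v

end PolylineDrawing

/-! After a shear the points of `S` have distinct abscissae and lie on the graph of a `K`-Lipschitz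
function `g`, which acts as a spine with an upper and a lower side. An arch leaves a point of the
spine with slope steeper than `K` and then drops vertically back to it, so it meets the spine only
at its two ends. Assign every vertex to a side by `up`. If a leaf and its root share a side, the
edge is a tent: one arch from the root whose drop ends at the leaf (one bend). Otherwise it is a
hook: an arch from each end, on opposite sides, with collinear drops that join on the spine at an
abscissa of no vertex (two bends). `ArchLayout` records what makes such a drawing planar.
`ArchSep.eq_of_onArch` handles two arches on one side, and arches on opposite sides can meet only on
the spine; `ArchLayout.exists_drawing` combines the two.

With at most two stars, each star gets its own side and only tents occur
(`archLayout_of_star_sides`). With at most two colors, each color gets its own side. Vertices may be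
permuted freely within a color, so on each side the stars can be made to occupy consecutive blocks,
in the same order of stars on both sides, with a root last in its block. All arches then run
leftwards: tents stay within their block, while hooks pass to the left of all vertices, and hooks of
later stars enclose the arches of earlier ones (`archLayout_of_monotone`). -/

/-! ### Combinatorics -/

/-- Two finite types of the same size with keys `α` and `β` are matched monotonically. -/
theorem exists_equiv_strictMono_key {A B : Type*} [Finite A] [Finite B]
    (hcard : Nat.card A = Nat.card B) (α : A → ℕ) (β : B → ℝ) (hβ : Function.Injective β) :
    ∃ f : A ≃ B, ∀ a b, α a < α b → β (f a) < β (f b) := by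
  classical
  have := Fintype.ofFinite A
  have := Fintype.ofFinite B
  let e : A ≃ Fin (Nat.card A) := Finite.equivFin A
  -- The enumeration `e` breaks ties of `α`, so that `A` becomes a linear order.
  let _ : LinearOrder A := LinearOrder.lift' (fun a => toLex (α a, e a)) fun a b hab => by
    simpa using (congrArg (fun z => (ofLex z).2) hab)
  let _ : LinearOrder B := LinearOrder.lift' β hβ
  let eA := Fintype.orderIsoFinOfCardEq A (k := Nat.card A) (by rw [Nat.card_eq_fintype_card])
  let eB := Fintype.orderIsoFinOfCardEq B (k := Nat.card A)
    (by rw [hcard, Nat.card_eq_fintype_card])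
  refine ⟨(eA.symm.trans eB).toEquiv, fun a b hab => ?_⟩
  have h1 : a < b := Prod.Lex.toLex_lt_toLex.2 (Or.inl hab)
  exact (eA.symm.trans eB).strictMono h1

/-- A color-preserving injection that is monotone on every color class. -/
theorem Compatible.exists_injective_strictMono_key {V : Type*} [Finite V] {k : ℕ}
    {colV : V → Fin k} {S : Finset Plane} {colS : S → Fin k} (hS : Compatible colV S colS)
    (α : V → ℕ) (β : S → ℝ) (hβ : Function.Injective β) :
    ∃ f : V → S, Function.Injective f ∧ (∀ v, colS (f v) = colV v) ∧
      ∀ v w, colV v = colV w → α v < α w → β (f v) < β (f w) := by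
  have h (i : Fin k) := exists_equiv_strictMono_key (hS i) (fun v => α v) (fun p => β p)
    (hβ.comp Subtype.val_injective)
  choose e he using h
  have hcol (v : V) : colS (e (colV v) ⟨v, rfl⟩).1 = colV v := (e (colV v) ⟨v, rfl⟩).2
  have key {i : Fin k} {v : V} (hv : colV v = i) :
      (e (colV v) ⟨v, rfl⟩).1 = (e i ⟨v, hv⟩).1 := by subst hv; rfl
  refine ⟨fun v => (e (colV v) ⟨v, rfl⟩).1, fun v w hvw => ?_, hcol, fun v w hc hlt => ?_⟩
  · have hc : colV v = colV w := by rw [← hcol v, ← hcol w]; exact congrArg colS hvw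
    simp only [key hc] at hvw
    simpa using (e (colV w)).injective (Subtype.ext hvw)
  · simp only [key hc]
    exact he _ _ _ hlt

/-- The roots of the stars of a forest of stars, together with a numbering of the stars. -/
theorem IsForestOfStars.exists_root {V : Type*} [Finite V] {F : SimpleGraph V} {h : ℕ}
    (hF : IsForestOfStars F h) :
    ∃ (root : V → V) (idx : V → ℕ), (∀ v, root (root v) = root v) ∧
      (∀ v w, idx v = idx w ↔ root v = root w) ∧ (∀ v, idx v < h) ∧
      ∀ e ∈ F.edgeSet, ∃ v, root v ≠ v ∧ e = s(root v, v) := by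
  obtain ⟨hcard, hstar⟩ := hF
  obtain ⟨r, hr, hadj⟩ : ∃ r : F.ConnectedComponent → V, (∀ C, F.connectedComponentMk (r C) = C) ∧
      ∀ u v, F.Adj u v → u = r (F.connectedComponentMk v) ∨ v = r (F.connectedComponentMk v) := by
    choose r hr using hstar
    refine ⟨fun C => (r C).1, fun C => (r C).2, fun u v huv => ?_⟩
    have hc : F.connectedComponentMk u = F.connectedComponentMk v :=
      SimpleGraph.ConnectedComponent.sound huv.reachable
    have h1 := (SimpleGraph.ConnectedComponent.toSimpleGraph_adj (F.connectedComponentMk v)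
      (u := u) (v := v) hc rfl).2 huv
    rw [hr, SimpleGraph.starGraph_adj] at h1
    exact h1.2.imp (congrArg Subtype.val) (congrArg Subtype.val)
  let e := Finite.equivFin F.ConnectedComponent
  refine ⟨fun v => r (F.connectedComponentMk v), fun v => (e (F.connectedComponentMk v)).1,
    fun v => by simp only [hr], fun v w => ?_, fun v => hcard ▸ (e _).2, fun a => ?_⟩
  · rw [Fin.val_inj, e.injective.eq_iff]
    refine ⟨fun hvw => by simp only [hvw], fun hvw => ?_⟩
    rw [← hr (F.connectedComponentMk v), ← hr (F.connectedComponentMk w)]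
    exact congrArg _ hvw
  · induction a with
    | h u v =>
      intro huv
      rw [SimpleGraph.mem_edgeSet] at huv
      have hc : F.connectedComponentMk u = F.connectedComponentMk v :=
        SimpleGraph.ConnectedComponent.sound huv.reachable
      rcases hadj u v huv with h2 | h2
      · exact ⟨v, by simpa only [← h2] using huv.ne, by simp only [← h2]⟩
      · exact ⟨u, by simpa only [hc, ← h2] using huv.ne', by simp only [hc, ← h2, Sym2.eq_swap]⟩

/-! ### Coordinates -/

/-- Only finitely many `c` are bad: each pair of points at different heights excludes one value, and
points at equal height are never merged. -/
theorem exists_shear_injOn (S : Finset Plane) :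
    ∃ c : ℝ, Set.InjOn (fun p : Plane => p 0 + c * p 1) S := by
  obtain ⟨c, hc⟩ := ((S ×ˢ S).image fun q : Plane × Plane =>
    -(q.1 0 - q.2 0) / (q.1 1 - q.2 1)).exists_notMem
  refine ⟨c, fun p hp q hq hpq => ?_⟩
  simp only at hpq
  by_contra hne
  have h1 : p 1 ≠ q 1 := fun h1 => hne <| by
    ext i; fin_cases i
    · simpa [h1] using hpq
    · exact h1
  refine hc (Finset.mem_image.2 ⟨(p, q), Finset.mem_product.2 ⟨hp, hq⟩, ?_⟩)
  have := sub_ne_zero.2 h1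
  simp only
  field_simp
  linarith

/-- The inverse of the shear `p ↦ (p 0 + c * p 1, p 1)`. -/
noncomputable def unshear (c : ℝ) : ℝ × ℝ →ₗ[ℝ] Plane where
  toFun z := !₂[z.1 - c * z.2, z.2]
  map_add' z w := by ext i; fin_cases i <;> simp; ring
  map_smul' t z := by ext i; fin_cases i <;> simp; ring

theorem unshear_shear (c : ℝ) (p : Plane) : unshear c (p 0 + c * p 1, p 1) = p := by
  ext i; fin_cases i <;> simp [unshear]

theorem unshear_injective (c : ℝ) : Function.Injective (unshear c) := by
  intro z w h
  have h0 := congrArg (fun p : Plane => p 0) h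
  have h1 := congrArg (fun p : Plane => p 1) h
  simp only [unshear, LinearMap.coe_mk, AddHom.coe_mk, PiLp.toLp_apply, Matrix.cons_val_zero,
    Matrix.cons_val_one] at h0 h1
  ext
  · simpa [h1] using h0
  · exact h1

/-- Interpolation of finitely many values by a Lipschitz function. -/
theorem exists_lipschitz_interpolation {V : Type*} [Finite V] (x y : V → ℝ)
    (hx : Function.Injective x) :
    ∃ (g : ℝ → ℝ) (K : ℝ), 0 ≤ K ∧ (∀ s t, |g s - g t| ≤ K * |s - t|) ∧ ∀ v, g (x v) = y v := by
  obtain ⟨K, hK⟩ := (Set.finite_range fun q : V × V => |y q.1 - y q.2| / |x q.1 - x q.2|).bddAbove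
  have hxy : ∀ v, Function.extend x y 0 (x v) = y v := fun v => hx.extend_apply y 0 v
  have hl : LipschitzOnWith K.toNNReal (Function.extend x y 0) (Set.range x) := by
    refine LipschitzOnWith.of_dist_le_mul ?_
    rintro _ ⟨v, rfl⟩ _ ⟨w, rfl⟩
    rw [hxy, hxy, Real.dist_eq, Real.dist_eq]
    rcases eq_or_ne v w with rfl | hvw
    · simp
    · have h0 : 0 < |x v - x w| := abs_pos.2 (sub_ne_zero.2 (hx.ne hvw))
      exact (div_le_iff₀ h0).1 ((hK ⟨(v, w), rfl⟩).trans (Real.le_coe_toNNReal K))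
  obtain ⟨g, hg, hgx⟩ := hl.extend_real
  refine ⟨g, K.toNNReal, NNReal.coe_nonneg _, fun s t => ?_, fun v => ?_⟩
  · simpa [Real.dist_eq] using hg.dist_le_mul s t
  · rw [← hgx ⟨v, rfl⟩, hxy]

/-! ### Arches -/

/-- The point `(x, y)` lies on the arch above the graph of `g` that starts at `(a, g a)`, rises with
slope `σ` until it is above `d`, and drops vertically to `(d, g d)`. -/
def OnArch (g : ℝ → ℝ) (a d σ x y : ℝ) : Prop :=
  (x ∈ Set.uIcc a d ∧ y = g a + σ * |x - a|) ∨ (x = d ∧ g d ≤ y ∧ y ≤ g a + σ * |d - a|)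

/-- Conditions under which two arches meet at most at a common starting point. -/
def ArchSep (a d σ a' d' σ' : ℝ) : Prop :=
  max a d < min a' d' ∨ (a ≤ a' ∧ d' < d ∧ d < a ∧ σ < σ') ∨ (a = a' ∧ d < a ∧ a < d') ∨
    (a = a' ∧ a < d ∧ d < d' ∧ σ < σ')

section

variable {g : ℝ → ℝ} {K a d σ a' d' σ' x y : ℝ}

theorem OnArch.mem_uIcc (h : OnArch g a d σ x y) : x ∈ Set.uIcc a d := by
  rcases h with h | ⟨rfl, -⟩
  · exact h.1
  · exact Set.right_mem_uIcc

/-- A slant steeper than the Lipschitz constant cannot return to the graph. -/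
theorem OnArch.le (hg : ∀ s t, |g s - g t| ≤ K * |s - t|) (hK : K < σ)
    (h : OnArch g a d σ x y) : g x ≤ y := by
  rcases h with ⟨-, rfl⟩ | ⟨rfl, h, -⟩
  · have h1 := (abs_le.1 (hg x a)).2
    nlinarith [abs_nonneg (x - a)]
  · exact h

theorem OnArch.eq_or_eq (hg : ∀ s t, |g s - g t| ≤ K * |s - t|) (hK : K < σ)
    (h : OnArch g a d σ x y) (hy : y = g x) : x = a ∨ x = d := by
  rcases h with ⟨-, h⟩ | ⟨h, -⟩
  · left
    by_contra hne
    have h0 : 0 < |x - a| := abs_pos.2 (sub_ne_zero.2 hne)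
    have h1 := (abs_le.1 (hg x a)).2
    nlinarith
  · exact Or.inr h

theorem OnArch.le_slant (h : OnArch g a d σ x y) : y ≤ g a + σ * |x - a| := by
  rcases h with ⟨-, h⟩ | ⟨rfl, -, h⟩
  · exact h.le
  · exact h

theorem OnArch.eq_slant (h : OnArch g a d σ x y) (hx : x ≠ d) : y = g a + σ * |x - a| := by
  rcases h with ⟨-, h⟩ | ⟨h, -⟩
  · exact h
  · exact absurd h hx

/-- The four cases of `ArchSep` are: disjoint projections; two arches running left, the second
enclosing the first; opposite directions from one start; two nested arches running right from one
start. In the nested cases the foot of the outer arch lies beyond the inner arch, so only its slant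
matters, and this stays above the inner arch. -/
theorem ArchSep.eq_of_onArch (hg : ∀ s t, |g s - g t| ≤ K * |s - t|) (hK : K < σ')
    (hs : ArchSep a d σ a' d' σ') (h : OnArch g a d σ x y) (h' : OnArch g a' d' σ' x y) :
    a = a' ∧ x = a ∧ y = g a := by
  have hx := h.mem_uIcc
  have hx' := h'.mem_uIcc
  have hy := h.le_slant
  have hy' := h'.eq_slant
  rw [Set.uIcc, Set.mem_Icc] at hx hx'
  rcases hs with hs | ⟨ha, hd, hda, hσ⟩ | ⟨rfl, hd, hd'⟩ | ⟨rfl, hd, hd', hσ⟩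
  · have h1 : a ⊔ d < a' ⊓ d' := hs
    linarith
  · rw [inf_eq_right.2 hda.le, sup_eq_left.2 hda.le] at hx
    have hy' := hy' (by linarith)
    rw [abs_of_nonpos (by linarith)] at hy hy'
    have h1 := (abs_le.1 (hg a a')).2
    rw [abs_of_nonpos (by linarith)] at h1
    -- At a common point the height comparison and the Lipschitz bound make the sum of these two
    -- nonnegative products at most `0`, so both vanish.
    have h2 : 0 ≤ (σ' - K) * (a' - a) := mul_nonneg (by linarith) (by linarith)
    have h3 : 0 ≤ (σ' - σ) * (a - x) := mul_nonneg (by linarith) (by linarith)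
    have h4 : (σ' - K) * (a' - a) = 0 := by nlinarith
    have h5 : (σ' - σ) * (a - x) = 0 := by nlinarith
    have h6 : a = a' := by
      rcases mul_eq_zero.1 h4 with h | h <;> linarith
    have h7 : x = a := by
      rcases mul_eq_zero.1 h5 with h | h <;> linarith
    subst h6 h7
    exact ⟨rfl, rfl, by simpa using hy'⟩
  · rw [inf_eq_right.2 hd.le, sup_eq_left.2 hd.le] at hx
    rw [inf_eq_left.2 hd'.le, sup_eq_right.2 hd'.le] at hx'
    have h1 : x = a := le_antisymm hx.2 hx'.1
    subst h1
    exact ⟨rfl, rfl, by simpa using hy' hd'.ne⟩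
  · rw [inf_eq_left.2 hd.le, sup_eq_right.2 hd.le] at hx
    have hy' := hy' (by linarith)
    rw [abs_of_nonneg (by linarith)] at hy hy'
    have h5 : x = a := by nlinarith
    subst h5
    exact ⟨rfl, rfl, by simpa using hy'⟩

end

/-! ### Segments -/

theorem mem_segment_slant {a d A B c : ℝ} (hB : B = A + c * |d - a|) {z : ℝ × ℝ}
    (hz : z ∈ segment ℝ (a, A) (d, B)) : z.1 ∈ Set.uIcc a d ∧ z.2 = A + c * |z.1 - a| := by
  subst hB
  rw [segment_eq_image'] at hz
  obtain ⟨t, ⟨h0, h1⟩, rfl⟩ := hz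
  constructor
  · rw [← segment_eq_uIcc, segment_eq_image']
    exact ⟨t, ⟨h0, h1⟩, by simp⟩
  · simp only [Prod.mk_sub_mk, Prod.smul_mk, Prod.mk_add_mk, smul_eq_mul]
    rw [add_sub_cancel_left, add_sub_cancel_left a, abs_mul, abs_of_nonneg h0]
    ring

theorem mem_segment_vertical {d B C : ℝ} {z : ℝ × ℝ}
    (hz : z ∈ segment ℝ (d, B) (d, C)) : z.1 = d ∧ z.2 ∈ Set.uIcc B C := by
  rw [segment_eq_image'] at hz
  obtain ⟨t, ht, rfl⟩ := hz
  refine ⟨by simp, ?_⟩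
  rw [← segment_eq_uIcc, segment_eq_image']
  exact ⟨t, ht, by simp⟩

/-! ### Polylines with one or two bends -/

section

variable {Φ : ℝ × ℝ →ₗ[ℝ] Plane} {a b c d : ℝ × ℝ}

theorem mem_segment_map_iff {x : Plane} :
    x ∈ segment ℝ (Φ a) (Φ b) ↔ ∃ z ∈ segment ℝ a b, Φ z = x := by
  have h := image_segment ℝ Φ.toAffineMap a b
  rw [← Set.mem_image]
  exact (Set.ext_iff.1 h x).symm

theorem mem_polylineSet_map_three {x : Plane} (hx : x ∈ polylineSet ([a, b, c].map Φ)) :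
    ∃ z, Φ z = x ∧ (z ∈ segment ℝ a b ∨ z ∈ segment ℝ b c) := by
  obtain ⟨i, hi, hx⟩ := hx
  simp only [List.map_cons, List.map_nil, List.length_cons, List.length_nil] at hi
  have : i = 0 ∨ i = 1 := by omega
  rcases this with rfl | rfl
  · obtain ⟨z, hz, rfl⟩ := mem_segment_map_iff.1 hx
    exact ⟨z, rfl, Or.inl hz⟩
  · obtain ⟨z, hz, rfl⟩ := mem_segment_map_iff.1 hx
    exact ⟨z, rfl, Or.inr hz⟩

theorem mem_polylineSet_map_four {x : Plane} (hx : x ∈ polylineSet ([a, b, c, d].map Φ)) :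
    ∃ z, Φ z = x ∧ (z ∈ segment ℝ a b ∨ z ∈ segment ℝ b c ∨ z ∈ segment ℝ c d) := by
  obtain ⟨i, hi, hx⟩ := hx
  simp only [List.map_cons, List.map_nil, List.length_cons, List.length_nil] at hi
  have : i = 0 ∨ i = 1 ∨ i = 2 := by omega
  rcases this with rfl | rfl | rfl
  · obtain ⟨z, hz, rfl⟩ := mem_segment_map_iff.1 hx
    exact ⟨z, rfl, Or.inl hz⟩
  · obtain ⟨z, hz, rfl⟩ := mem_segment_map_iff.1 hx
    exact ⟨z, rfl, Or.inr (Or.inl hz)⟩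
  · obtain ⟨z, hz, rfl⟩ := mem_segment_map_iff.1 hx
    exact ⟨z, rfl, Or.inr (Or.inr hz)⟩

theorem isSimplePolyline_map_three (hΦ : Function.Injective Φ) (hn : [a, b, c].Nodup)
    (h : ∀ z ∈ segment ℝ a b, z ∈ segment ℝ b c → z = b) :
    IsSimplePolyline ([a, b, c].map Φ) where
  two_le := by simp
  nodup := hn.map hΦ
  inter i j hij hj x hx hx' := by
    simp only [List.map_cons, List.map_nil, List.length_cons, List.length_nil] at hj
    obtain ⟨rfl, rfl⟩ : i = 0 ∧ j = 1 := by omega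
    obtain ⟨z, hz, rfl⟩ := mem_segment_map_iff.1 hx
    obtain ⟨z', hz', h'⟩ := mem_segment_map_iff.1 hx'
    obtain rfl := hΦ h'
    exact ⟨rfl, congrArg Φ (h z' hz hz')⟩

theorem isSimplePolyline_map_four (hΦ : Function.Injective Φ) (hn : [a, b, c, d].Nodup)
    (h : ∀ z ∈ segment ℝ a b, z ∈ segment ℝ b c → z = b)
    (h' : ∀ z ∈ segment ℝ b c, z ∈ segment ℝ c d → z = c)
    (h'' : ∀ z ∈ segment ℝ a b, z ∉ segment ℝ c d) :
    IsSimplePolyline ([a, b, c, d].map Φ) where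
  two_le := by simp
  nodup := hn.map hΦ
  inter i j hij hj x hx hx' := by
    simp only [List.map_cons, List.map_nil, List.length_cons, List.length_nil] at hj
    have : (i = 0 ∧ j = 1) ∨ (i = 1 ∧ j = 2) ∨ (i = 0 ∧ j = 2) := by omega
    rcases this with ⟨rfl, rfl⟩ | ⟨rfl, rfl⟩ | ⟨rfl, rfl⟩ <;>
    · obtain ⟨z, hz, rfl⟩ := mem_segment_map_iff.1 hx
      obtain ⟨w, hw, hzw⟩ := mem_segment_map_iff.1 hx'
      obtain rfl := hΦ hzw
      first
        | exact ⟨rfl, congrArg Φ (h w hz hw)⟩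
        | exact ⟨rfl, congrArg Φ (h' w hz hw)⟩
        | exact absurd hw (h'' w hz)

end

/-! ### Layouts of star forests -/

/-- `1` on the upper side, `-1` on the lower side. -/
def sideSign (s : Bool) : ℝ := if s then 1 else -1

/-- Membership in an arch above (`s = true`) or below (`s = false`) the graph of `g`. -/
def OnSideArch (s : Bool) (g : ℝ → ℝ) (a d σ x y : ℝ) : Prop :=
  OnArch (fun t => sideSign s * g t) a d σ x (sideSign s * y)

theorem abs_sideSign_mul_sub_le {g : ℝ → ℝ} {K : ℝ} (hg : ∀ s t, |g s - g t| ≤ K * |s - t|)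
    (b : Bool) (s t : ℝ) : |sideSign b * g s - sideSign b * g t| ≤ K * |s - t| := by
  rw [← mul_sub, abs_mul]
  cases b <;> simpa [sideSign] using hg s t

theorem sideSign_mul_cancel {b : Bool} {s t : ℝ} (h : sideSign b * s = sideSign b * t) :
    s = t := by
  cases b <;> simpa [sideSign] using h

section

variable {V : Type*} (root : V → V) (up : V → Bool)

/-- The vertex at which the part of the edge from `v` to its root on side `s` starts. -/
def anchor (s : Bool) (v : V) : V := if up (root v) = s then root v else v

/-- The edge from `v` to its root has a part on side `s`. -/
def HasPart (s : Bool) (v : V) : Prop := up v = s ∨ up (root v) = s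

/-- Data for drawing a forest of stars with given roots, where vertex `v` lies at
`(x v, g (x v))`. The edge from `v` to its root has arches of slope `σ v` and vertical part at
`d v`. -/
structure ArchLayout (x : V → ℝ) (K : ℝ) (d σ : V → ℝ) : Prop where
  slope : ∀ v, root v ≠ v → K < σ v
  tent : ∀ v, root v ≠ v → up v = up (root v) → d v = x v
  hook : ∀ v, root v ≠ v → up v ≠ up (root v) → ∀ w, d v ≠ x w
  ne : ∀ v w, root v ≠ v → root w ≠ w → v ≠ w → d v ≠ d w
  sep : ∀ s v w, root v ≠ v → root w ≠ w → v ≠ w → HasPart root up s v → HasPart root up s w →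
    ArchSep (x (anchor root up s v)) (d v) (σ v) (x (anchor root up s w)) (d w) (σ w) ∨
    ArchSep (x (anchor root up s w)) (d w) (σ w) (x (anchor root up s v)) (d v) (σ v)

/-- The corner points of the edge from `v` to its root. -/
noncomputable def archLine (x : V → ℝ) (g : ℝ → ℝ) (d σ : V → ℝ) (v : V) : List (ℝ × ℝ) :=
  if up v = up (root v) then
    [(x (root v), g (x (root v))),
      (d v, g (x (root v)) + sideSign (up v) * σ v * |d v - x (root v)|), (x v, g (x v))]
  else
    [(x (anchor root up true v), g (x (anchor root up true v))),
      (d v, g (x (anchor root up true v)) + σ v * |d v - x (anchor root up true v)|),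
      (d v, g (x (anchor root up false v)) + -σ v * |d v - x (anchor root up false v)|),
      (x (anchor root up false v), g (x (anchor root up false v)))]

end

section

variable {V : Type*} {root : V → V} {up : V → Bool} {x : V → ℝ} {g : ℝ → ℝ} {K : ℝ}
  {d σ : V → ℝ}

theorem anchor_eq_or (s : Bool) (v : V) :
    anchor root up s v = root v ∨ anchor root up s v = v := by
  unfold anchor
  split_ifs
  · exact Or.inl rfl
  · exact Or.inr rfl

theorem HasPart.up_anchor {s : Bool} {v : V} (h : HasPart root up s v) :
    up (anchor root up s v) = s := by
  unfold anchor
  split_ifs with h1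
  · exact h1
  · exact h.resolve_right h1

theorem anchor_of_eq {s : Bool} {v : V} (h : up (root v) = s) : anchor root up s v = root v :=
  if_pos h

theorem hasPart_of_ne {v : V} (h : up v ≠ up (root v)) (s : Bool) : HasPart root up s v := by
  unfold HasPart
  revert h
  cases up v <;> cases up (root v) <;> cases s <;> simp

namespace ArchLayout

theorem d_ne_anchor (hL : ArchLayout root up x K d σ) (hx : Function.Injective x) {v : V}
    (hv : root v ≠ v) {s : Bool} (h : HasPart root up s v) : d v ≠ x (anchor root up s v) := by
  by_cases hs : up v = up (root v)
  · have h1 : up (root v) = s := by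
      rcases h with h | h
      · rw [← hs, h]
      · exact h
    rw [hL.tent v hv hs, anchor_of_eq h1]
    exact hx.ne hv.symm
  · exact hL.hook v hv hs _

/-- The apex of an arch lies strictly on the correct side. -/
theorem lt_apex (hL : ArchLayout root up x K d σ) (hg : ∀ s t, |g s - g t| ≤ K * |s - t|)
    (hx : Function.Injective x) {v : V}
    (hv : root v ≠ v) {s : Bool} (h : HasPart root up s v) :
    sideSign s * g (d v) < sideSign s * g (x (anchor root up s v)) +
      σ v * |d v - x (anchor root up s v)| := by
  have h0 : 0 < |d v - x (anchor root up s v)| :=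
    abs_pos.2 (sub_ne_zero.2 (hL.d_ne_anchor hx hv h))
  have h1 := (abs_le.1 (abs_sideSign_mul_sub_le hg s (d v) (x (anchor root up s v)))).2
  have h2 := hL.slope v hv
  nlinarith

theorem onSideArch_le (hL : ArchLayout root up x K d σ)
    (hg : ∀ s t, |g s - g t| ≤ K * |s - t|) {v : V} (hv : root v ≠ v) {s : Bool} {a X Y : ℝ}
    (h : OnSideArch s g a (d v) (σ v) X Y) : sideSign s * g X ≤ sideSign s * Y :=
  OnArch.le (g := fun t => sideSign s * g t) (abs_sideSign_mul_sub_le hg s) (hL.slope v hv) h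

theorem onSideArch_eq_or_eq (hL : ArchLayout root up x K d σ)
    (hg : ∀ s t, |g s - g t| ≤ K * |s - t|) {v : V} (hv : root v ≠ v) {s : Bool} {a X Y : ℝ}
    (h : OnSideArch s g a (d v) (σ v) X Y) (hY : Y = g X) : X = a ∨ X = d v :=
  OnArch.eq_or_eq (abs_sideSign_mul_sub_le hg s) (hL.slope v hv) h (by rw [hY])

/-- Arches on different sides meet only on the graph of `g`. -/
theorem eq_of_onSideArch_of_ne (hL : ArchLayout root up x K d σ)
    (hg : ∀ s t, |g s - g t| ≤ K * |s - t|) {v w : V} (hv : root v ≠ v) (hw : root w ≠ w)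
    {s s' : Bool} (hs : s ≠ s') {a a' X Y : ℝ} (h : OnSideArch s g a (d v) (σ v) X Y)
    (h' : OnSideArch s' g a' (d w) (σ w) X Y) : Y = g X := by
  have h1 := hL.onSideArch_le hg hv h
  have h2 := hL.onSideArch_le hg hw h'
  revert hs h1 h2
  cases s <;> cases s' <;> simp [sideSign] <;> intros <;> linarith

theorem onSideArch_slant (s : Bool) {a : ℝ} {v : V} {z : ℝ × ℝ}
    (hz : z ∈ segment ℝ (a, g a) (d v, g a + sideSign s * σ v * |d v - a|)) :
    OnSideArch s g a (d v) (σ v) z.1 z.2 := by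
  obtain ⟨h1, h2⟩ := mem_segment_slant rfl hz
  refine Or.inl ⟨h1, ?_⟩
  rw [h2]
  cases s <;> simp [sideSign]; ring

theorem mem_archLine_tent (hL : ArchLayout root up x K d σ)
    (hg : ∀ s t, |g s - g t| ≤ K * |s - t|) (hx : Function.Injective x) {v : V}
    (hv : root v ≠ v) (hs : up v = up (root v)) {z : ℝ × ℝ}
    (hz : z ∈ segment ℝ (d v, g (x (root v)) + sideSign (up v) * σ v * |d v - x (root v)|)
      (x v, g (x v))) : OnSideArch (up v) g (x (root v)) (d v) (σ v) z.1 z.2 := by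
  have h0 := hL.lt_apex hg hx hv (s := up v) (Or.inl rfl)
  rw [anchor_of_eq hs.symm] at h0
  rw [← hL.tent v hv hs] at hz
  obtain ⟨h1, h2⟩ := mem_segment_vertical hz
  refine Or.inr ⟨h1, ?_⟩
  rw [Set.uIcc, Set.mem_Icc] at h2
  revert h2 h0
  cases up v <;> simp only [sideSign] <;> intro h0 h2
  · simp at h0 h2 ⊢
    rcases h2 with ⟨h3 | h3, h4 | h4⟩ <;> constructor <;> linarith
  · simp at h0 h2 ⊢
    rcases h2 with ⟨h3 | h3, h4 | h4⟩ <;> constructor <;> linarith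

/-- The two apices lie strictly above and below the graph at `d v`, so the graph cuts the vertical
segment into the drops of the two arches. -/
theorem mem_archLine_hook (hL : ArchLayout root up x K d σ)
    (hg : ∀ s t, |g s - g t| ≤ K * |s - t|) (hx : Function.Injective x) {v : V}
    (hv : root v ≠ v) (hs : up v ≠ up (root v)) {a b : ℝ}
    (ha : a = x (anchor root up true v)) (hb : b = x (anchor root up false v)) {z : ℝ × ℝ}
    (hz : z ∈ segment ℝ (d v, g a + σ v * |d v - a|) (d v, g b + -σ v * |d v - b|)) :
    OnSideArch true g a (d v) (σ v) z.1 z.2 ∨ OnSideArch false g b (d v) (σ v) z.1 z.2 := by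
  have h0 := hL.lt_apex hg hx hv (hasPart_of_ne hs true)
  have h0' := hL.lt_apex hg hx hv (hasPart_of_ne hs false)
  rw [← ha] at h0
  rw [← hb] at h0'
  simp [sideSign] at h0 h0'
  obtain ⟨h1, h2⟩ := mem_segment_vertical hz
  rw [Set.uIcc_of_ge (by linarith), Set.mem_Icc] at h2
  rcases le_total (g (d v)) z.2 with h3 | h3
  · refine Or.inl (Or.inr ⟨h1, ?_⟩)
    simp [sideSign]
    exact ⟨h3, h2.2⟩
  · refine Or.inr (Or.inr ⟨h1, ?_⟩)
    simp [sideSign]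
    exact ⟨h3, by linarith [h2.1]⟩

theorem onSideArch_of_mem_archLine (hL : ArchLayout root up x K d σ)
    (hg : ∀ s t, |g s - g t| ≤ K * |s - t|) (hx : Function.Injective x)
    {Φ : ℝ × ℝ →ₗ[ℝ] Plane} {v : V} (hv : root v ≠ v) {p : Plane}
    (hp : p ∈ polylineSet ((archLine root up x g d σ v).map Φ)) :
    ∃ z s, Φ z = p ∧ HasPart root up s v ∧
      OnSideArch s g (x (anchor root up s v)) (d v) (σ v) z.1 z.2 := by
  unfold archLine at hp
  split_ifs at hp with hs
  · obtain ⟨z, rfl, hz⟩ := mem_polylineSet_map_three hp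
    refine ⟨z, up v, rfl, Or.inl rfl, ?_⟩
    rw [anchor_of_eq hs.symm]
    rcases hz with hz | hz
    · exact onSideArch_slant _ hz
    · exact hL.mem_archLine_tent hg hx hv hs hz
  · obtain ⟨z, rfl, hz⟩ := mem_polylineSet_map_four hp
    rcases hz with hz | hz | hz
    · exact ⟨z, true, rfl, hasPart_of_ne hs _, onSideArch_slant _ (by simpa [sideSign] using hz)⟩
    · rcases hL.mem_archLine_hook hg hx hv hs rfl rfl hz with h | h
      · exact ⟨z, true, rfl, hasPart_of_ne hs _, h⟩
      · exact ⟨z, false, rfl, hasPart_of_ne hs _, h⟩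
    · rw [segment_symm] at hz
      exact ⟨z, false, rfl, hasPart_of_ne hs _, onSideArch_slant _ (by simpa [sideSign] using hz)⟩

theorem isSimplePolyline_archLine (hL : ArchLayout root up x K d σ)
    (hg : ∀ s t, |g s - g t| ≤ K * |s - t|) (hx : Function.Injective x)
    {Φ : ℝ × ℝ →ₗ[ℝ] Plane} (hΦ : Function.Injective Φ) {v : V} (hv : root v ≠ v) :
    IsSimplePolyline ((archLine root up x g d σ v).map Φ) := by
  unfold archLine
  split_ifs with hs
  · have hd := hL.d_ne_anchor hx hv (s := up v) (Or.inl rfl)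
    have h0 := hL.lt_apex hg hx hv (s := up v) (Or.inl rfl)
    rw [anchor_of_eq hs.symm] at hd h0
    have hdv := hL.tent v hv hs
    refine isSimplePolyline_map_three hΦ ?_ fun z hz hz' => ?_
    · have h1 : g (x (root v)) + sideSign (up v) * σ v * |d v - x (root v)| ≠ g (x v) := by
        intro h
        rw [← hdv] at h
        rw [← h] at h0
        revert h0
        cases up v <;> simp [sideSign]
      simp [hd.symm, h1, hx.ne hv]
    · rw [← hdv] at hz'
      obtain ⟨h1, -⟩ := mem_segment_vertical hz'
      obtain ⟨-, h2⟩ := mem_segment_slant rfl hz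
      exact Prod.ext h1 (by rw [h2, h1])
  · have hT := hL.d_ne_anchor hx hv (hasPart_of_ne hs true)
    have hF := hL.d_ne_anchor hx hv (hasPart_of_ne hs false)
    have h0T := hL.lt_apex hg hx hv (hasPart_of_ne hs true)
    have h0F := hL.lt_apex hg hx hv (hasPart_of_ne hs false)
    have hTF : x (anchor root up true v) ≠ x (anchor root up false v) := by
      refine hx.ne fun h => ?_
      have h1 := (hasPart_of_ne hs true).up_anchor
      rw [h, (hasPart_of_ne hs false).up_anchor] at h1
      exact absurd h1 (by simp)
    simp only [sideSign, Bool.false_eq_true, if_true, if_false] at h0T h0F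
    refine isSimplePolyline_map_four hΦ ?_ (fun z hz hz' => ?_) (fun z hz hz' => ?_)
      fun z hz hz' => ?_
    · simp only [List.nodup_cons, List.mem_cons, Prod.mk.injEq, List.not_mem_nil, or_false,
        not_or, not_and, List.nodup_nil, and_true, not_false_eq_true]
      refine ⟨⟨fun h => absurd h.symm hT, fun h => absurd h.symm hT, fun h => absurd h hTF⟩,
        ⟨fun _ h => ?_, fun h => absurd h hF⟩, fun h => absurd h hF⟩
      linarith
    · obtain ⟨h1, -⟩ := mem_segment_vertical hz'
      obtain ⟨-, h2⟩ := mem_segment_slant rfl hz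
      exact Prod.ext h1 (by rw [h2, h1])
    · rw [segment_symm] at hz'
      obtain ⟨h1, -⟩ := mem_segment_vertical hz
      obtain ⟨-, h2⟩ := mem_segment_slant rfl hz'
      exact Prod.ext h1 (by rw [h2, h1])
    · rw [segment_symm] at hz'
      have h1 := onSideArch_slant (g := g) (σ := σ) true (by simpa [sideSign] using hz)
      have h2 := onSideArch_slant (g := g) (σ := σ) false (by simpa [sideSign] using hz')
      -- A common point of the two slants would lie on the graph. There it is the start of an arch
      -- or has abscissa `d v`; the starts differ from each other and from `d v`, and over `d v` the
      -- slant is at its apex, off the graph.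
      have h3 := hL.eq_of_onSideArch_of_ne hg hv hv (by simp) h1 h2
      obtain ⟨-, h4⟩ := mem_segment_slant rfl hz
      obtain ⟨-, h5⟩ := mem_segment_slant rfl hz'
      rcases hL.onSideArch_eq_or_eq hg hv h1 h3 with h6 | h6
      · rcases hL.onSideArch_eq_or_eq hg hv h2 h3 with h7 | h7
        · exact hTF (h6.symm.trans h7)
        · exact hT (h7.symm.trans h6)
      · rw [h3, h6] at h4
        linarith

/-- A layout of a forest of stars yields a planar drawing with at most two bends per edge. -/
theorem exists_drawing {F : SimpleGraph V} (hL : ArchLayout root up x K d σ)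
    (hF : ∀ e ∈ F.edgeSet, ∃ v, root v ≠ v ∧ e = s(root v, v))
    (hg : ∀ s t, |g s - g t| ≤ K * |s - t|) (hx : Function.Injective x)
    {Φ : ℝ × ℝ →ₗ[ℝ] Plane} (hΦ : Function.Injective Φ) :
    ∃ D : PolylineDrawing F, (∀ v, D.pos v = Φ (x v, g (x v))) ∧ D.curveComplexity ≤ 2 := by
  choose leaf hleaf he using fun e : F.edgeSet => hF e e.2
  have hend (e : F.edgeSet) (s : Bool) : anchor root up s (leaf e) ∈ (e : Sym2 V) := by
    rw [he e, Sym2.mem_iff]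
    exact anchor_eq_or s _
  let D : PolylineDrawing F :=
    { pos := fun v => Φ (x v, g (x v))
      pos_injective := fun v w h => hx (congrArg Prod.fst (hΦ h))
      line := fun e => (archLine root up x g d σ (leaf e)).map Φ
      simple := fun e => hL.isSimplePolyline_archLine hg hx hΦ (hleaf e)
      ends := fun e => by
        by_cases hs : up (leaf e) = up (root (leaf e))
        · exact ⟨root (leaf e), leaf e, he e, by simp [archLine, hs], by simp [archLine, hs]⟩
        · refine ⟨anchor root up true (leaf e), anchor root up false (leaf e), ?_,
            by simp [archLine, hs], by simp [archLine, hs]⟩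
          rw [he e]
          unfold anchor
          revert hs
          cases up (leaf e) <;> cases up (root (leaf e)) <;> simp [Sym2.eq_swap]
      avoid := fun e w hw => by
        obtain ⟨z, s, hz, hp, ha⟩ := hL.onSideArch_of_mem_archLine hg hx (hleaf e) hw
        obtain rfl := hΦ hz
        rcases hL.onSideArch_eq_or_eq hg (hleaf e) ha rfl with h | h
        · rw [hx h]
          exact hend e s
        · by_cases hs : up (leaf e) = up (root (leaf e))
          · rw [hL.tent _ (hleaf e) hs] at h
            rw [he e, hx h]
            exact Sym2.mem_mk_right _ _
          · exact absurd h.symm (hL.hook _ (hleaf e) hs w)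
      noncrossing := fun e f hef p hp => by
        obtain ⟨z, s, rfl, hpe, hz⟩ := hL.onSideArch_of_mem_archLine hg hx (hleaf e) hp.1
        obtain ⟨z', s', hz', hpf, ha⟩ := hL.onSideArch_of_mem_archLine hg hx (hleaf f) hp.2
        obtain rfl := hΦ hz'
        have hne : leaf e ≠ leaf f := fun h => hef (Subtype.ext (by rw [he e, he f, h]))
        by_cases hs : s = s'
        · subst hs
          have key : x (anchor root up s (leaf e)) = x (anchor root up s (leaf f)) ∧
              z'.1 = x (anchor root up s (leaf e)) ∧
              sideSign s * z'.2 = sideSign s * g (x (anchor root up s (leaf e))) := by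
            rcases hL.sep s _ _ (hleaf e) (hleaf f) hne hpe hpf with h | h
            · exact h.eq_of_onArch (abs_sideSign_mul_sub_le hg s) (hL.slope _ (hleaf f)) hz ha
            · obtain ⟨h1, h2, h3⟩ := h.eq_of_onArch (abs_sideSign_mul_sub_le hg s)
                (hL.slope _ (hleaf e)) ha hz
              rw [← h1]
              exact ⟨rfl, h2, h3⟩
          obtain ⟨h1, h2, h3⟩ := key
          refine ⟨anchor root up s (leaf e), hend e s, ?_, ?_⟩
          · rw [hx h1]
            exact hend f s
          · exact congrArg Φ (Prod.ext h2 (sideSign_mul_cancel h3))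
        -- The common point lies on the graph, hence is a start or a foot of both arches. Starts
        -- belong to different sides. The foot of a tent is a leaf on the tent's own side and the
        -- foot of a hook is no vertex, so a foot is never a start on the other side. Two feet are
        -- distinct by `ne`.
        · exfalso
          have hY := hL.eq_of_onSideArch_of_ne hg (hleaf e) (hleaf f) hs hz ha
          have hup : anchor root up s (leaf e) ≠ anchor root up s' (leaf f) := fun h =>
            hs (by rw [← hpe.up_anchor, h, hpf.up_anchor])
          have hd {e f : F.edgeSet} {s s' : Bool} (hss : s ≠ s') (h1 : HasPart root up s (leaf e))
              (h2 : HasPart root up s' (leaf f)) :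
              d (leaf e) ≠ x (anchor root up s' (leaf f)) := by
            by_cases h : up (leaf e) = up (root (leaf e))
            · rw [hL.tent _ (hleaf e) h]
              refine hx.ne fun h3 => hss ?_
              rw [← h2.up_anchor, ← h3]
              rcases h1 with h1 | h1
              · exact h1.symm
              · rw [h, h1]
            · exact hL.hook _ (hleaf e) h _
          rcases hL.onSideArch_eq_or_eq hg (hleaf e) hz hY with h1 | h1 <;>
            rcases hL.onSideArch_eq_or_eq hg (hleaf f) ha hY with h2 | h2
          · exact hup (hx (h1.symm.trans h2))
          · exact hd (Ne.symm hs) hpf hpe (h2.symm.trans h1)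
          · exact hd hs hpe hpf (h1.symm.trans h2)
          · exact hL.ne _ _ (hleaf e) (hleaf f) hne (h1.symm.trans h2) }
  refine ⟨D, fun _ => rfl, iSup_le fun e => ?_⟩
  have : D.bends e ≤ 2 := by
    change ((archLine root up x g d σ (leaf e)).map Φ).length - 2 ≤ 2
    unfold archLine
    split_ifs <;> simp
  exact_mod_cast this

end ArchLayout

end

/-! ### Layouts for two stars and for two colors -/

section

variable {V : Type*} {root : V → V} {up : V → Bool} {x : V → ℝ} {K M : ℝ} {idx : V → ℕ}

/-- If every side carries at most one star, then all edges can be drawn as tents. -/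
theorem archLayout_of_star_sides (hx : Function.Injective x)
    (hup : ∀ v w, up v = up w ↔ root v = root w) (hroot : ∀ v, root (root v) = root v) :
    ArchLayout root up x K x (fun v => K + 1 + |x v - x (root v)|) where
  slope v _ := by linarith [abs_nonneg (x v - x (root v))]
  tent _ _ _ := rfl
  hook v _ h := absurd ((hup _ _).2 (hroot v).symm) h
  ne _ _ _ _ h := hx.ne h
  sep s v w hv hw hvw hsv hsw := by
    have hs (u : V) (hu : HasPart root up s u) : up (root u) = s := by
      rcases hu with hu | hu
      · rw [← hu, hup, hroot]
      · exact hu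
    rw [anchor_of_eq (hs v hsv), anchor_of_eq (hs w hsw)]
    have hr : root v = root w := by
      rw [← hroot v, ← hroot w, ← hup, hs v hsv, hs w hsw]
    rw [← hr] at hw ⊢
    have h1 := hx.ne hv
    have h2 := hx.ne hw
    have h3 := hx.ne hvw
    unfold ArchSep
    -- Leaves on the same side of the root along the axis give nested tents, the farther leaf having
    -- the steeper one; leaves on opposite sides give tents in opposite directions.
    rcases lt_or_gt_of_ne h1 with h1 | h1 <;> rcases lt_or_gt_of_ne h2 with h2 | h2
    · rw [abs_of_pos (sub_pos.2 h1), abs_of_pos (sub_pos.2 h2)]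
      rcases lt_or_gt_of_ne h3 with h3 | h3
      · exact Or.inl (Or.inr (Or.inr (Or.inr ⟨rfl, h1, h3, by linarith⟩)))
      · exact Or.inr (Or.inr (Or.inr (Or.inr ⟨rfl, h2, h3, by linarith⟩)))
    · exact Or.inr (Or.inr (Or.inr (Or.inl ⟨rfl, h2, h1⟩)))
    · exact Or.inl (Or.inr (Or.inr (Or.inl ⟨rfl, h1, h2⟩)))
    · rw [abs_of_neg (sub_neg.2 h1), abs_of_neg (sub_neg.2 h2)]
      rcases lt_or_gt_of_ne h3 with h3 | h3
      · exact Or.inr (Or.inr (Or.inl ⟨le_rfl, h3, h2, by linarith⟩))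
      · exact Or.inl (Or.inr (Or.inl ⟨le_rfl, h3, h1, by linarith⟩))

/-- The slope of the arches of the edge from `v` to its root. -/
noncomputable def nestedSlope (root : V → V) (up : V → Bool) (x : V → ℝ) (K M : ℝ) (idx : V → ℕ)
    (v : V) : ℝ :=
  -- For `|x v| < M` the tent term lies in `(0, 2M)` and the hook term in `(2M, 4M)`: within a star
  -- hooks enclose tents, and different stars use disjoint bands. The signs of `x v` differ because
  -- the outer tent belongs to the leaf farther left, whereas the outer hook must start at the leaf
  -- farther right.
  K + 1 + 4 * M * idx v + if up v = up (root v) then M - x v else 3 * M + x v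

/-- The abscissa of the vertical part of the edge from `v` to its root. -/
noncomputable def nestedShift (root : V → V) (up : V → Bool) (x : V → ℝ) (K M : ℝ) (idx : V → ℕ)
    (v : V) : ℝ :=
  -- A hook turns to the left of all vertices, and farther left the steeper it is.
  if up v = up (root v) then x v else -M - nestedSlope root up x K M idx v

theorem nestedSlope_bounds (hM : ∀ v, |x v| < M) (v : V) :
    K + 1 + 4 * M * idx v < nestedSlope root up x K M idx v ∧
      nestedSlope root up x K M idx v < K + 1 + 4 * M * (idx v + 1) := by
  have h := abs_lt.1 (hM v)
  unfold nestedSlope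
  split_ifs <;> constructor <;> linarith

theorem nestedSlope_lt_of_idx_lt (hM : ∀ v, |x v| < M) {v w : V} (h : idx v < idx w) :
    nestedSlope root up x K M idx v < nestedSlope root up x K M idx w := by
  have h1 : (idx v : ℝ) + 1 ≤ idx w := by exact_mod_cast h
  have h2 : 0 < M := (abs_nonneg _).trans_lt (hM v)
  have h3 := (nestedSlope_bounds (K := K) (idx := idx) (root := root) (up := up) hM v).2
  have h4 := (nestedSlope_bounds (K := K) (idx := idx) (root := root) (up := up) hM w).1
  nlinarith

theorem lt_nestedSlope (hM : ∀ v, |x v| < M) (v : V) : K + 1 < nestedSlope root up x K M idx v := by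
  have h2 : 0 < M := (abs_nonneg _).trans_lt (hM v)
  have h4 := (nestedSlope_bounds (K := K) (idx := idx) (root := root) (up := up) hM v).1
  have h5 : 0 ≤ 4 * M * idx v := by positivity
  linarith

theorem nestedShift_hook_lt (hK : 0 ≤ K) (hM : ∀ v, |x v| < M) {v : V}
    (h : up v ≠ up (root v)) (w : V) : nestedShift root up x K M idx v < x w := by
  have h1 := lt_nestedSlope (K := K) (idx := idx) (root := root) (up := up) hM v
  have h2 := (abs_lt.1 (hM w)).1
  rw [nestedShift, if_neg h]
  linarith

/-- Nesting within a star requires the steeper arch to reach farther left, for every combination of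
tents and hooks. -/
theorem nestedShift_lt_of_slope_lt (hK : 0 ≤ K) (hM : ∀ v, |x v| < M) {v w : V}
    (hi : idx v = idx w) (h : nestedSlope root up x K M idx v < nestedSlope root up x K M idx w) :
    nestedShift root up x K M idx w < nestedShift root up x K M idx v := by
  by_cases hw : up w = up (root w)
  · by_cases hv : up v = up (root v)
    · rw [nestedShift, nestedShift, if_pos hw, if_pos hv]
      rw [nestedSlope, nestedSlope, if_pos hw, if_pos hv, hi] at h
      linarith
    · rw [nestedSlope, nestedSlope, if_pos hw, if_neg hv, hi] at h
      linarith [(abs_lt.1 (hM v)).1, (abs_lt.1 (hM w)).1]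
  · by_cases hv : up v = up (root v)
    · rw [nestedShift.eq_1 root up x K M idx v, if_pos hv]
      exact nestedShift_hook_lt hK hM hw v
    · rw [nestedShift, nestedShift, if_neg hw, if_neg hv]
      linarith

theorem nestedSlope_ne (hx : Function.Injective x) (hM : ∀ v, |x v| < M) {v w : V} (hvw : v ≠ w)
    (hi : idx v = idx w) : nestedSlope root up x K M idx v ≠ nestedSlope root up x K M idx w := by
  intro h
  have h1 := abs_lt.1 (hM v)
  have h2 := abs_lt.1 (hM w)
  rw [nestedSlope, nestedSlope, hi] at h
  split_ifs at h
  · exact hvw (hx (by linarith))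
  · linarith
  · linarith
  · exact hvw (hx (by linarith))

/-- If on every side the stars occupy consecutive groups of vertices, with the root as the last
vertex of its group, then the edges can be drawn as nested tents and hooks. -/
theorem archLayout_of_monotone (hx : Function.Injective x) (hK : 0 ≤ K) (hM : ∀ v, |x v| < M)
    (hroot : ∀ v w, idx v = idx w ↔ root v = root w) (hroot' : ∀ v, root (root v) = root v)
    (hlt : ∀ v w, up v = up w → idx v < idx w → x v < x w)
    (hlast : ∀ v, root v ≠ v → up v = up (root v) → x v < x (root v)) :
    ArchLayout root up x K (nestedShift root up x K M idx) (nestedSlope root up x K M idx) where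
  slope v _ := by linarith [lt_nestedSlope (K := K) (idx := idx) (root := root) (up := up) hM v]
  tent v _ h := if_pos h
  hook v _ h w := (nestedShift_hook_lt hK hM h w).ne
  ne v w hv hw hvw := by
    by_cases h : up v = up (root v)
    · by_cases h' : up w = up (root w)
      · rw [nestedShift, nestedShift, if_pos h, if_pos h']
        exact hx.ne hvw
      · rw [nestedShift, if_pos h]
        exact (nestedShift_hook_lt hK hM h' v).ne'
    · by_cases h' : up w = up (root w)
      · rw [nestedShift.eq_1 root up x K M idx w, if_pos h']
        exact (nestedShift_hook_lt hK hM h w).ne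
      · rw [nestedShift, nestedShift, if_neg h, if_neg h']
        intro heq
        have heq : nestedSlope root up x K M idx v = nestedSlope root up x K M idx w := by linarith
        rcases lt_trichotomy (idx v) (idx w) with hi | hi | hi
        · exact (nestedSlope_lt_of_idx_lt hM hi).ne heq
        · exact nestedSlope_ne hx hM hvw hi heq
        · exact (nestedSlope_lt_of_idx_lt hM hi).ne' heq
  sep s := by
    have hanchor (v : V) : idx (anchor root up s v) = idx v := by
      rcases anchor_eq_or (root := root) (up := up) s v with h | h
      · rw [h, hroot, hroot']
      · rw [h]
    have hshift (v : V) (hv : root v ≠ v) (hs : HasPart root up s v) :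
        nestedShift root up x K M idx v < x (anchor root up s v) := by
      by_cases h : up v = up (root v)
      · have h1 : up (root v) = s := by
          rcases hs with h1 | h1
          · rw [← h, h1]
          · exact h1
        rw [nestedShift, if_pos h, anchor_of_eq h1]
        exact hlast v hv h
      · exact nestedShift_hook_lt hK hM h _
    have hsep (v w : V) (hv : root v ≠ v) (hsv : HasPart root up s v)
        (hsw : HasPart root up s w) (h : idx v < idx w) :
        ArchSep (x (anchor root up s v)) (nestedShift root up x K M idx v)
          (nestedSlope root up x K M idx v) (x (anchor root up s w))
          (nestedShift root up x K M idx w) (nestedSlope root up x K M idx w) := by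
      have ha : x (anchor root up s v) < x (anchor root up s w) :=
        hlt _ _ (by rw [hsv.up_anchor, hsw.up_anchor]) (by rwa [hanchor, hanchor])
      -- A tent of the later star lies entirely to the right of the arch of `v`; a hook of the later
      -- star encloses that arch.
      by_cases hw : up w = up (root w)
      · have h1 : up w = s := by
          rcases hsw with h1 | h1
          · exact h1
          · rw [hw, h1]
        have h2 : x (anchor root up s v) < nestedShift root up x K M idx w := by
          rw [nestedShift, if_pos hw]
          exact hlt _ _ (by rw [hsv.up_anchor, h1]) (by rwa [hanchor])
        exact Or.inl (max_lt (lt_min ha h2) ((hshift v hv hsv).trans (lt_min ha h2)))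
      · have h1 := nestedSlope_lt_of_idx_lt (K := K) (root := root) (up := up) hM h
        refine Or.inr (Or.inl ⟨ha.le, ?_, hshift v hv hsv, h1⟩)
        by_cases h2 : up v = up (root v)
        · rw [nestedShift.eq_1 root up x K M idx v, if_pos h2]
          exact nestedShift_hook_lt hK hM hw v
        · rw [nestedShift, nestedShift, if_neg hw, if_neg h2]
          linarith
    have hsep' (v w : V) (hv : root v ≠ v) (hsv : HasPart root up s v)
        (hsw : HasPart root up s w) (hi : idx v = idx w)
        (h : nestedSlope root up x K M idx v < nestedSlope root up x K M idx w) :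
        ArchSep (x (anchor root up s v)) (nestedShift root up x K M idx v)
          (nestedSlope root up x K M idx v) (x (anchor root up s w))
          (nestedShift root up x K M idx w) (nestedSlope root up x K M idx w) := by
      refine Or.inr (Or.inl ⟨?_, nestedShift_lt_of_slope_lt hK hM hi h, hshift v hv hsv, h⟩)
      have hr := (hroot v w).1 hi
      -- On the root's side both arches start at the root. On the other side both edges are hooks
      -- starting at their leaves, and the steeper one starts farther right.
      by_cases h1 : up (root v) = s
      · rw [anchor_of_eq h1, anchor_of_eq (hr ▸ h1), hr]
      · have h2 : up (root w) ≠ s := hr ▸ h1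
        have h3 : up v ≠ up (root v) := by rw [hsv.resolve_right h1]; exact Ne.symm h1
        have h4 : up w ≠ up (root w) := by rw [hsw.resolve_right h2]; exact Ne.symm h2
        rw [anchor, anchor, if_neg h1, if_neg h2]
        rw [nestedSlope, nestedSlope, if_neg h3, if_neg h4, hi] at h
        linarith
    intro v w hv hw hvw hsv hsw
    rcases lt_trichotomy (idx v) (idx w) with hi | hi | hi
    · exact Or.inl (hsep v w hv hsv hsw hi)
    · rcases lt_or_gt_of_ne (nestedSlope_ne (K := K) (root := root) (up := up) hx hM hvw hi)
        with h | h
      · exact Or.inl (hsep' v w hv hsv hsw hi h)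
      · exact Or.inr (hsep' w v hw hsw hsv hi.symm h)
    · exact Or.inr (hsep w v hw hsw hsv hi)

end

/-! ### Assembly of the colored embedding -/

theorem mainTheorem7 {V : Type*} [Finite V] (k h : ℕ) (F : SimpleGraph V)
    (hF : IsForestOfStars F h) (colV : V → Fin k) (S : Finset Plane) (colS : S → Fin k)
    (hS : Compatible colV S colS) (hkh : min k h ≤ 2) :
    ∃ D : PolylineDrawing F, D.IsColoredEmbeddingOn colV S colS ∧ D.curveComplexity ≤ 2 := by
  classical
  obtain ⟨root, idx, hroot, hidx, hidxh, hedge⟩ := hF.exists_root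
  obtain ⟨c, hc⟩ := exists_shear_injOn S
  obtain ⟨f, hf, hcol, hmono⟩ := hS.exists_injective_strictMono_key
    -- This key sorts each color class by star and puts a root after the leaves of its star. Only
    -- the two-color case uses the order.
    (fun v => 2 * idx v + if root v = v then 1 else 0) (fun p => p.1 0 + c * p.1 1)
    (fun p q hpq => Subtype.ext (hc p.2 q.2 hpq))
  let x : V → ℝ := fun v => (f v).1 0 + c * (f v).1 1
  have hx : Function.Injective x := fun v w hvw => hf (Subtype.ext (hc (f v).2 (f w).2 hvw))
  obtain ⟨g, K, hK, hg, hgx⟩ := exists_lipschitz_interpolation x (fun v => (f v).1 1) hx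
  suffices hL : ∃ up d σ, ArchLayout root up x K d σ by
    obtain ⟨up, d, σ, hL⟩ := hL
    obtain ⟨D, hD, hD2⟩ := hL.exists_drawing hedge hg hx (unshear_injective c)
    refine ⟨D, fun v => ?_, hD2⟩
    have h1 : D.pos v = (f v).1 := by
      rw [hD, hgx]
      exact unshear_shear c _
    exact ⟨h1 ▸ (f v).2, by simp only [h1]; exact hcol v⟩
  rcases min_le_iff.1 hkh with hk | hh
  · obtain ⟨M, hM⟩ := (Set.finite_range fun v => |x v|).bddAbove
    -- As `k ≤ 2`, a side is a single color class, so the monotonicity within colors applies to the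
    -- sides.
    have hup (v w : V) (h : decide ((colV v).1 = 0) = decide ((colV w).1 = 0)) :
        colV v = colV w := by
      have h1 := decide_eq_decide.1 h
      ext
      omega
    refine ⟨fun v => decide ((colV v).1 = 0), _, _, archLayout_of_monotone (idx := idx)
      (M := M + 1) hx hK (fun v => by linarith [hM ⟨v, rfl⟩]) hidx hroot (fun v w hvw hlt => ?_)
      fun v hv hvr => ?_⟩
    · refine hmono v w (hup v w hvw) ?_
      split_ifs <;> omega
    · refine hmono v (root v) (hup v _ hvr) ?_
      rw [if_neg hv, if_pos (hroot v), (hidx v (root v)).2 (hroot v).symm]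
      omega
  · refine ⟨fun v => decide (idx v = 0), _, _, archLayout_of_star_sides hx (fun v w => ?_) hroot⟩
    rw [decide_eq_decide, ← hidx]
    have h1 := hidxh v
    have h2 := hidxh w
    omega
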